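/- Let $n\ge 1$ be an integer and let $\mathbb{B}_n$ be the open unit ball of $\mathbb{C}^n$ for the canonical Hermitian norm. Let $F_n^2$ be the full Fock space of $\mathbb{C}^n$, i.e. the Hilbert space with orthonormal basis $e_{i_1}\otimes\cdots\otimes e_{i_k}$ ($k\ge 0$, $1\le i_1,\dots,i_k\le n$; for $k=0$ this is the vacuum vector $1$), and let $S_1,\dots,S_n$ be the left creation operators, $S_j(e_{i_1}\otimes\cdots\otimes e_{i_k})=e_j\otimes e_{i_1}\otimes\cdots\otimes e_{i_k}$, $S_j(1)=e_j$. Let $F_n^\infty\subseteq\mathcal{B}(F_n^2)$ be the closure in the weak operator topology of the unital algebra generated by $S_1,\dots,S_n$, with the operator norm. For $\varphi\in F_n^\infty$ and $\lambda\in\mathbb{B}_n$ write $\varphi(\lambda)=\pi_\lambda(\varphi)$, where $\pi_\lambda$ is the unique unital algebra homomorphism $F_n^\infty\to\mathbb{C}$ that is continuous for the weak* topology (the restriction of the weak operator topology) and satisfies $\pi_\lambda(S_j)=\lambda_j$ for $j=1,\dots,n$. For $z,w\in\mathbb{B}_n$ there is a biholomorphic map $f$ of $\mathbb{B}_n$ onto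 itself with $f(z)=0$, and $\|f(w)\|_{\mathbb{C}^n}$ is the same for all such $f$; this common value is the Poincaré pseudohyperbolic distance $\rho(z,w)$. Then for all $z,w\in\mathbb{B}_n$ \[ \rho(z,w)=\max\left\{|\varphi(z)| : \varphi\in F_n^\infty,\ \|\varphi\|_{F_n^\infty}\le 1,\ \varphi(w)=0\right\}, \] and in particular this maximum is attained. -/

import Mathlib

/-- The open unit ball of `ℂⁿ` for the canonical Hermitian norm. -/
abbrev UnitBall (n : ℕ) : Set (EuclideanSpace ℂ (Fin n)) := Metric.ball 0 1

/-- Automorphisms of the ball: biholomorphic maps of the unit ball of `ℂⁿ` onto itself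
(the values of `f` outside of the ball are irrelevant). -/
def IsBallAutomorphism {n : ℕ} (f : EuclideanSpace ℂ (Fin n) → EuclideanSpace ℂ (Fin n)) : Prop :=
  DifferentiableOn ℂ f (UnitBall n) ∧ Set.MapsTo f (UnitBall n) (UnitBall n) ∧
    ∃ g : EuclideanSpace ℂ (Fin n) → EuclideanSpace ℂ (Fin n),
      DifferentiableOn ℂ g (UnitBall n) ∧ Set.MapsTo g (UnitBall n) (UnitBall n) ∧
        Set.InvOn g f (UnitBall n) (UnitBall n)

/-- All the values of the Euclidean distance between `0` and the image of `w` by an automorphism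
of the ball which maps `z` to `0`. -/
def pseudohyperbolicValues {n : ℕ} (z w : UnitBall n) : Set ℝ :=
  {r | ∃ f : EuclideanSpace ℂ (Fin n) → EuclideanSpace ℂ (Fin n),
    IsBallAutomorphism f ∧ f z = 0 ∧ r = dist 0 (f w)}

/-- The Poincaré pseudohyperbolic distance: the Euclidean distance between `0` and the image
of `w` by any automorphism of the ball which maps `z` to `0`. The set of values is a singleton,
and `sInf` reads off its element. -/
noncomputable def pseudohyperbolicDist {n : ℕ} (z w : UnitBall n) : ℝ :=
  sInf (pseudohyperbolicValues z w)

/-- The full Fock space of `ℂⁿ`, in coordinates: the Hilbert space completion of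
`⨁ₖ (ℂⁿ)^{⊗ k}` has the orthonormal basis `e_{i₁} ⊗ ⋯ ⊗ e_{iₖ}`, indexed by the words
`[i₁, …, iₖ]` in the letters `1, …, n`; the empty word is the vacuum vector. -/
abbrev FockSpace (n : ℕ) : Type := lp (fun _ : List (Fin n) => ℂ) 2

namespace FockSpace

/-- The basis vector `e_{i₁} ⊗ ⋯ ⊗ e_{iₖ}` of the word `α = [i₁, …, iₖ]`. -/
noncomputable def e {n : ℕ} (α : List (Fin n)) : FockSpace n := lp.single 2 α (1 : ℂ)

/-- The isometric embedding of `ℂ` on the line of a basis vector. -/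
noncomputable def line {n : ℕ} (α : List (Fin n)) : ℂ →ₗᵢ[ℂ] FockSpace n where
  toLinearMap := lp.lsingle (E := fun _ : List (Fin n) => ℂ) 2 α
  norm_map' c := lp.norm_single (E := fun _ : List (Fin n) => ℂ) (p := 2) (by norm_num) α c

theorem orthogonalFamily_line_cons {n : ℕ} (j : Fin n) :
    OrthogonalFamily ℂ (fun _ : List (Fin n) => ℂ) (fun α => line (j :: α)) := by
  intro α β h v w
  have h2 : (j :: α) ≠ (j :: β) := by simpa using h
  change inner ℂ (lp.single 2 (j :: α) v : FockSpace n) (lp.single 2 (j :: β) w) = 0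
  rw [lp.inner_single_left, lp.single_apply_ne _ _ _ h2, inner_zero_right]

/-- The left creation operator `S_j`, which maps `e_α` to `e_j ⊗ e_α`. -/
noncomputable def creation {n : ℕ} (j : Fin n) : FockSpace n →L[ℂ] FockSpace n :=
  (orthogonalFamily_line_cons j).linearIsometry.toContinuousLinearMap

theorem creation_e {n : ℕ} (j : Fin n) (α : List (Fin n)) : creation j (e α) = e (j :: α) :=
  (orthogonalFamily_line_cons j).linearIsometry_apply_single (1 : ℂ)

end FockSpace

open FockSpace in
/-- The noncommutative Hardy algebra `F_n^∞`: the closure, in the weak operator topology, of the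
unital algebra generated by the left creation operators. Its norm is the operator norm. -/
noncomputable def hardyAlgebra (n : ℕ) : Subalgebra ℂ (FockSpace n →L[ℂ] FockSpace n) :=
  (Algebra.adjoin ℂ (Set.range fun j : Fin n =>
    ContinuousLinearMapWOT.ofCLM (creation j))).topologicalClosure.map
      (ContinuousLinearMapWOT.algEquiv ℂ).toAlgHom

namespace hardyAlgebra

theorem mem_iff {n : ℕ} {A : FockSpace n →L[ℂ] FockSpace n} :
    A ∈ hardyAlgebra n ↔ ContinuousLinearMapWOT.ofCLM A ∈
      closure (Algebra.adjoin ℂ (Set.range fun j : Fin n =>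
        ContinuousLinearMapWOT.ofCLM (FockSpace.creation j)) :
          Set (FockSpace n →WOT[ℂ] FockSpace n)) := by
  constructor
  · rintro ⟨B, hB, rfl⟩
    exact hB
  · intro h
    exact ⟨_, h, rfl⟩

/-- The generator `S_j` as an element of `F_n^∞`. -/
noncomputable def S {n : ℕ} (j : Fin n) : hardyAlgebra n :=
  ⟨FockSpace.creation j, mem_iff.2 (subset_closure (Algebra.subset_adjoin ⟨j, rfl⟩))⟩

/-- An element of `F_n^∞` in the space of operators with the weak operator topology. -/
noncomputable def toWOT {n : ℕ} (φ : hardyAlgebra n) : FockSpace n →WOT[ℂ] FockSpace n :=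
  ContinuousLinearMapWOT.ofCLM (φ : FockSpace n →L[ℂ] FockSpace n)

/-- The weak* topology of `F_n^∞`, which is the restriction of the weak operator topology. -/
@[reducible]
noncomputable def weakStarTopology (n : ℕ) : TopologicalSpace (hardyAlgebra n) :=
  TopologicalSpace.induced toWOT inferInstance

open scoped Topology in
/-- `π` is a weak* scalar representation of `F_n^∞` with `π (S_j) = l_j` for all `j`. -/
def IsRepresentationAt {n : ℕ} (l : EuclideanSpace ℂ (Fin n)) (π : hardyAlgebra n →ₐ[ℂ] ℂ) : Prop :=
  Continuous[weakStarTopology n, inferInstanceAs (TopologicalSpace ℂ)] π ∧ ∀ j, π (S j) = l j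

theorem summable_words {n : ℕ} (l : UnitBall n) :
    Summable fun α : List (Fin n) => ‖(α.map l.1).prod‖ ^ 2 := by
  have hl : ∑ i, ‖l.1 i‖ ^ 2 < 1 := by
    have h1 : ‖l.1‖ < 1 := mem_ball_zero_iff.1 l.2
    rw [← EuclideanSpace.norm_sq_eq]
    nlinarith [norm_nonneg l.1]
  rw [← List.equivSigmaTuple.symm.summable_iff]
  have key : ∀ k (f : Fin k → Fin n),
      ‖((List.ofFn f).map l.1).prod‖ ^ 2 = ∏ i, ‖l.1 (f i)‖ ^ 2 := by
    intro k f
    rw [List.map_ofFn, List.prod_ofFn, norm_prod, Finset.prod_pow]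
    rfl
  rw [summable_sigma_of_nonneg]
  · refine ⟨fun k => Summable.of_finite, ?_⟩
    have : ∀ k, ∑' f : Fin k → Fin n, ‖((List.ofFn f).map l.1).prod‖ ^ 2
        = (∑ i, ‖l.1 i‖ ^ 2) ^ k := by
      intro k
      simp only [key]
      rw [tsum_fintype, Finset.sum_pow']
      simp
    refine (summable_geometric_of_lt_one (by positivity) hl).congr fun k => ?_
    exact (this k).symm
  · intro x
    exact sq_nonneg _

/-- The vector `∑_α conj (l_α) e_α`. -/
noncomputable def kernelVector {n : ℕ} (l : UnitBall n) : FockSpace n :=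
  ⟨fun α => star (α.map l.1).prod, by
    refine (memℓp_gen_iff (by norm_num)).2 ?_
    simpa using summable_words l⟩

theorem inner_kernelVector_e {n : ℕ} (l : UnitBall n) (α : List (Fin n)) :
    inner ℂ (kernelVector l) (FockSpace.e α) = (α.map l.1).prod := by
  rw [FockSpace.e, lp.inner_single_right]
  simp [kernelVector]

theorem inner_kernelVector_creation {n : ℕ} (l : UnitBall n) (j : Fin n) (x : FockSpace n) :
    inner ℂ (kernelVector l) (FockSpace.creation j x) = l.1 j * inner ℂ (kernelVector l) x := by
  have hx := lp.hasSum_single (p := 2) (by norm_num) x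
  have h1 := ((innerSL ℂ (kernelVector l)).comp (FockSpace.creation j)).hasSum hx
  have h2 := (l.1 j • innerSL ℂ (kernelVector l)).hasSum hx
  refine h1.unique ?_
  have h4 : (l.1 j • innerSL ℂ (kernelVector l)) x = l.1 j * inner ℂ (kernelVector l) x := rfl
  rw [h4] at h2
  convert h2 using 1
  funext α
  have h3 : (lp.single 2 α (x α) : FockSpace n) = x α • FockSpace.e α := by
    rw [FockSpace.e, ← lp.single_smul]; simp
  simp only [h3, map_smul, ContinuousLinearMap.comp_apply, FockSpace.creation_e,
    innerSL_apply_apply, inner_kernelVector_e, smul_apply, List.map_cons,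
    List.prod_cons, smul_eq_mul]

theorem inner_kernelVector_apply {n : ℕ} (l : UnitBall n) (φ : hardyAlgebra n) (x : FockSpace n) :
    inner ℂ (kernelVector l) (φ.1 x) =
      inner ℂ (kernelVector l) (φ.1 (FockSpace.e [])) * inner ℂ (kernelVector l) x := by
  have hclosed : IsClosed {A : FockSpace n →WOT[ℂ] FockSpace n | inner ℂ (kernelVector l) (A x) =
      inner ℂ (kernelVector l) (A (FockSpace.e [])) * inner ℂ (kernelVector l) x} := by
    have hc : ∀ y, Continuous fun A : FockSpace n →WOT[ℂ] FockSpace n =>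
        inner ℂ (kernelVector l) (A y) :=
      fun y => ContinuousLinearMapWOT.continuous_dual_apply y (innerSL ℂ (kernelVector l))
    exact isClosed_eq (hc x) ((hc _).mul continuous_const)
  refine closure_minimal ?_ hclosed (mem_iff.1 φ.2)
  intro A hA
  have key : ∃ c : ℂ, ∀ y, inner ℂ (kernelVector l) (A y) = c * inner ℂ (kernelVector l) y := by
    induction hA using Algebra.adjoin_induction with
    | mem A hA =>
      obtain ⟨j, rfl⟩ := hA
      exact ⟨l.1 j, inner_kernelVector_creation l j⟩
    | algebraMap r =>
      refine ⟨r, fun y => ?_⟩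
      rw [Algebra.algebraMap_eq_smul_one]
      exact inner_smul_right _ _ _
    | add A B _ _ hA hB =>
      obtain ⟨a, ha⟩ := hA
      obtain ⟨b, hb⟩ := hB
      refine ⟨a + b, fun y => ?_⟩
      rw [ContinuousLinearMapWOT.add_apply, inner_add_right, ha, hb, add_mul]
    | mul A B _ _ hA hB =>
      obtain ⟨a, ha⟩ := hA
      obtain ⟨b, hb⟩ := hB
      refine ⟨a * b, fun y => ?_⟩
      change inner ℂ (kernelVector l) (A (B y)) = _
      rw [ha, hb, mul_assoc]
  obtain ⟨c, hc⟩ := key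
  simp only [Set.mem_ofPred_eq, hc, inner_kernelVector_e]
  simp

theorem representation_unique {n : ℕ} {l : EuclideanSpace ℂ (Fin n)}
    {π π' : hardyAlgebra n →ₐ[ℂ] ℂ} (h : IsRepresentationAt l π) (h' : IsRepresentationAt l π') :
    π = π' := by
  let _ := weakStarTopology n
  have hcl : IsClosed {φ : hardyAlgebra n | π φ = π' φ} := isClosed_eq h.1 h'.1
  obtain ⟨C, hC, hCeq⟩ := isClosed_induced_iff.1 hcl
  have hsub : ∀ A ∈ Algebra.adjoin ℂ (Set.range fun j : Fin n =>
      ContinuousLinearMapWOT.ofCLM (FockSpace.creation j)),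
      ∃ φ : hardyAlgebra n, toWOT φ = A ∧ π φ = π' φ := by
    intro A hA
    induction hA using Algebra.adjoin_induction with
    | mem A hA =>
      obtain ⟨j, rfl⟩ := hA
      exact ⟨S j, rfl, by rw [h.2, h'.2]⟩
    | algebraMap r =>
      exact ⟨algebraMap ℂ _ r, rfl, by rw [AlgHom.commutes, AlgHom.commutes]⟩
    | add A B _ _ hA hB =>
      obtain ⟨φ, rfl, hφ⟩ := hA
      obtain ⟨ψ, rfl, hψ⟩ := hB
      exact ⟨φ + ψ, rfl, (π.map_add' φ ψ).trans ((congrArg₂ _ hφ hψ).trans (π'.map_add' φ ψ).symm)⟩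
    | mul A B _ _ hA hB =>
      obtain ⟨φ, rfl, hφ⟩ := hA
      obtain ⟨ψ, rfl, hψ⟩ := hB
      exact ⟨φ * ψ, rfl, (π.map_mul' φ ψ).trans ((congrArg₂ _ hφ hψ).trans (π'.map_mul' φ ψ).symm)⟩
  ext φ
  have hφ : toWOT φ ∈ C := by
    refine closure_minimal ?_ hC (mem_iff.1 φ.2)
    intro A hA
    obtain ⟨ψ, rfl, hψ⟩ := hsub A hA
    have : ψ ∈ toWOT ⁻¹' C := hCeq.symm ▸ hψ
    exact this
  have : φ ∈ {φ : hardyAlgebra n | π φ = π' φ} := hCeq ▸ hφ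
  exact this

theorem exists_representation {n : ℕ} (l : UnitBall n) :
    ∃ π : hardyAlgebra n →ₐ[ℂ] ℂ, IsRepresentationAt l.1 π := by
  have he : inner ℂ (kernelVector l) (FockSpace.e []) = (1 : ℂ) := by
    simp [inner_kernelVector_e]
  refine ⟨AlgHom.ofLinearMap
    { toFun := fun φ => inner ℂ (kernelVector l) (φ.1 (FockSpace.e []))
      map_add' := fun φ ψ => inner_add_right _ _ _
      map_smul' := fun c φ => inner_smul_right _ _ _ } he ?_, ?_, ?_⟩
  · intro φ ψ
    exact inner_kernelVector_apply l φ (ψ.1 (FockSpace.e []))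
  · have hc : Continuous fun A : FockSpace n →WOT[ℂ] FockSpace n =>
        inner ℂ (kernelVector l) (A (FockSpace.e [])) :=
      ContinuousLinearMapWOT.continuous_dual_apply _ (innerSL ℂ (kernelVector l))
    let _ := weakStarTopology n
    have ht : Continuous (toWOT (n := n)) := continuous_induced_dom
    exact hc.comp ht
  · intro j
    change inner ℂ (kernelVector l) (FockSpace.creation j (FockSpace.e [])) = l.1 j
    rw [inner_kernelVector_creation, he, mul_one]

/-- For every point `l` of the ball there is exactly one weak* scalar representation of `F_n^∞`
which maps `S_j` to `l_j` for all `j`. -/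
theorem existsUnique_representation {n : ℕ} (l : UnitBall n) :
    ∃! π : hardyAlgebra n →ₐ[ℂ] ℂ, IsRepresentationAt l.1 π := by
  obtain ⟨π, hπ⟩ := exists_representation l
  exact ⟨π, hπ, fun π' h' => representation_unique h' hπ⟩

/-- The weak* scalar representation `π_l` of `F_n^∞` with `π_l (S_j) = l_j`. -/
noncomputable def representationAt {n : ℕ} (l : UnitBall n) : hardyAlgebra n →ₐ[ℂ] ℂ :=
  (existsUnique_representation l).choose

/-- The value `φ(l) = π_l(φ)` of `φ ∈ F_n^∞` at the point `l` of the ball. -/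
noncomputable def eval {n : ℕ} (φ : hardyAlgebra n) (l : UnitBall n) : ℂ :=
  representationAt l φ

end hardyAlgebra

/-!
The involution `f_z` of the ball exchanging `0` and `z` sends `z` to `0`, so by the Schwarz lemma
`ρ(z, w) = ‖f_z(w)‖`.

Upper bound: the kernel vectors `k_l` are eigenvectors of `φ*`, with eigenvalue `conj φ(l)`. If
`φ(w) = 0`, the contraction `φ*` kills `k_w`, so `‖φ* k_z‖` is at most the distance from `k_z` to
the line of `k_w`. This is `ρ(z, w) ‖k_z‖`, because `⟪k_z, k_w⟫ = (1 - ⟪w, z⟫)⁻¹`.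

Lower bound: for `‖c‖ ≤ 1`, substitute the row contraction `(S_1, …, S_n)` for the variable in
`⟪c, f_w⟫`. The identity which gives `1 - ‖f_w(l)‖² = (1 - ‖w‖²)(1 - ‖l‖²) / |1 - ⟪w, l⟫|²`
holds for operators, so the result is a contraction in `F_n^∞`; it vanishes at `w` and takes the
value `⟪c, f_w(z)⟫` at `z`, which is `‖f_w(z)‖ = ρ(z, w)` for `c` in the direction of `f_w(z)`.
-/

section Contraction

variable {𝕜 E F : Type*} [RCLike 𝕜] [NormedAddCommGroup E] [InnerProductSpace 𝕜 E]
  [SeminormedAddCommGroup F] [Module 𝕜 F]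

theorem norm_sq_map_mul_norm_sq_le_of_map_eq_zero {T : E →ₗ[𝕜] F}
    (hT : ∀ x, ‖T x‖ ≤ ‖x‖) {v : E} (hv : T v = 0) (u : E) :
    ‖T u‖ ^ 2 * ‖v‖ ^ 2 ≤ ‖u‖ ^ 2 * ‖v‖ ^ 2 - ‖inner 𝕜 v u‖ ^ 2 := by
  have hproj : ‖(𝕜 ∙ v).starProjection u‖ * ‖v‖ = ‖inner 𝕜 v u‖ := by
    rcases eq_or_ne v 0 with rfl | hv0
    · simp
    have h := congrArg norm (Submodule.smul_starProjection_singleton 𝕜 (v := v) u)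
    rw [norm_smul, norm_smul, RCLike.norm_ofReal, abs_of_nonneg (by positivity)] at h
    refine mul_right_cancel₀ (norm_ne_zero_iff.2 hv0) ?_
    rw [← h]
    ring
  have hmap : T ((𝕜 ∙ v)ᗮ.starProjection u) = T u := by
    conv_rhs => rw [← (𝕜 ∙ v).starProjection_add_starProjection_orthogonal u]
    obtain ⟨c, hc⟩ := Submodule.mem_span_singleton.1 ((𝕜 ∙ v).starProjection_apply_mem u)
    rw [map_add, ← hc, map_smul, hv, smul_zero, zero_add]
  have hle : ‖T u‖ ^ 2 ≤ ‖u‖ ^ 2 - ‖(𝕜 ∙ v).starProjection u‖ ^ 2 := by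
    rw [(𝕜 ∙ v).norm_sq_eq_add_norm_sq_starProjection u, add_sub_cancel_left, ← hmap]
    exact pow_le_pow_left₀ (norm_nonneg _) (hT _) 2
  calc ‖T u‖ ^ 2 * ‖v‖ ^ 2 ≤ (‖u‖ ^ 2 - ‖(𝕜 ∙ v).starProjection u‖ ^ 2) * ‖v‖ ^ 2 := by gcongr
    _ = ‖u‖ ^ 2 * ‖v‖ ^ 2 - ‖inner 𝕜 v u‖ ^ 2 := by
      rw [sub_mul, ← mul_pow ‖(𝕜 ∙ v).starProjection u‖, hproj]

end Contraction

section Mobius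

variable {𝕜 E F : Type*} [RCLike 𝕜] [SeminormedAddCommGroup E] [InnerProductSpace 𝕜 E]
  [SeminormedAddCommGroup F] [InnerProductSpace 𝕜 F]

-- For `A c = c • a` and `y = 1` this is the identity for `‖ballInvolution 𝕜 a v‖`; for `A` a column
-- operator and `v = R† y` it is the identity behind `norm_adjoint_mobius_apply_le`.
theorem norm_sq_map_sub_smul_sub_smul {A : E → F} {B : F → E} {s : ℝ} (hs : 1 + s ≠ 0)
    (hAB : ∀ x v, inner 𝕜 (A x) v = inner 𝕜 x (B v))
    (hA : ∀ x, ‖A x‖ ^ 2 = (1 - s ^ 2) * ‖x‖ ^ 2) (y : E) (v : F) :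
    ‖A (y - (1 + s : 𝕜)⁻¹ • B v) - (s : 𝕜) • v‖ ^ 2 =
      ‖y - B v‖ ^ 2 - s ^ 2 * (‖y‖ ^ 2 - ‖v‖ ^ 2) := by
  have hscal : (1 + s : 𝕜)⁻¹ = ((1 + s)⁻¹ : ℝ) := by push_cast; rfl
  have hinner : RCLike.re (inner 𝕜 (y - (1 + s : 𝕜)⁻¹ • B v) (B v)) =
      RCLike.re (inner 𝕜 y (B v)) - (1 + s)⁻¹ * ‖B v‖ ^ 2 := by
    rw [hscal, inner_sub_left, inner_smul_left, RCLike.conj_ofReal, map_sub, RCLike.re_ofReal_mul,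
      inner_self_eq_norm_sq]
  have hnorm : ‖y - (1 + s : 𝕜)⁻¹ • B v‖ ^ 2 = ‖y‖ ^ 2 -
      2 * ((1 + s)⁻¹ * RCLike.re (inner 𝕜 y (B v))) + (1 + s)⁻¹ ^ 2 * ‖B v‖ ^ 2 := by
    rw [hscal, norm_sub_sq (𝕜 := 𝕜), inner_smul_right, RCLike.re_ofReal_mul, norm_smul, mul_pow,
      RCLike.norm_ofReal, sq_abs]
  rw [norm_sub_sq (𝕜 := 𝕜), hA, inner_smul_right, hAB, RCLike.re_ofReal_mul, hinner, hnorm,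
    norm_smul, mul_pow, RCLike.norm_ofReal, sq_abs, norm_sub_sq (𝕜 := 𝕜)]
  field_simp
  ring

end Mobius

section Adjoint

open ContinuousLinearMap

variable {𝕜 E F G : Type*} [RCLike 𝕜]
  [NormedAddCommGroup E] [InnerProductSpace 𝕜 E] [CompleteSpace E]
  [NormedAddCommGroup F] [InnerProductSpace 𝕜 F] [CompleteSpace F]
  [NormedAddCommGroup G] [InnerProductSpace 𝕜 G] [CompleteSpace G]

theorem norm_comp_le_norm_comp_of_norm_adjoint_apply_le {H : Type*} [NormedAddCommGroup H]
    [InnerProductSpace 𝕜 H] [CompleteSpace H] {S : E →L[𝕜] F} {T : G →L[𝕜] F}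
    (h : ∀ y, ‖adjoint S y‖ ≤ ‖adjoint T y‖) (C : F →L[𝕜] H) : ‖C ∘L S‖ ≤ ‖C ∘L T‖ := by
  rw [← LinearIsometryEquiv.norm_map adjoint (C ∘L S),
    ← LinearIsometryEquiv.norm_map adjoint (C ∘L T)]
  refine opNorm_le_bound _ (norm_nonneg _) fun y => ?_
  rw [adjoint_comp, comp_apply]
  refine (h _).trans ?_
  rw [← comp_apply, ← adjoint_comp]
  exact le_opNorm _ _

theorem norm_adjoint_mobius_apply_le {A : E →L[𝕜] F} {C : G →L[𝕜] F} {R : F →L[𝕜] E} {s : ℝ}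
    (hs : 1 + s ≠ 0) (hA : ∀ x, ‖A x‖ ^ 2 = (1 - s ^ 2) * ‖x‖ ^ 2) (hC : ‖C‖ ≤ 1) (hR : ‖R‖ ≤ 1)
    (y : E) :
    ‖adjoint ((1 - (1 + s : 𝕜)⁻¹ • R ∘L A) ∘L adjoint A ∘L C - (s : 𝕜) • R ∘L C) y‖ ≤
      ‖adjoint (1 - R ∘L A) y‖ := by
  have hadj : adjoint ((1 - (1 + s : 𝕜)⁻¹ • R ∘L A) ∘L adjoint A ∘L C - (s : 𝕜) • R ∘L C) y =
      adjoint C (A (y - (1 + s : 𝕜)⁻¹ • adjoint A (adjoint R y)) - (s : 𝕜) • adjoint R y) := by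
    simp only [map_sub, map_smulₛₗ, adjoint_comp, adjoint_adjoint, sub_apply, smul_apply,
      comp_apply, map_inv₀, map_add, map_one, RCLike.conj_ofReal, one_def, adjoint_id, id_apply,
      RingHom.id_apply]
  have hadj' : adjoint (1 - R ∘L A) y = y - adjoint A (adjoint R y) := by
    simp only [map_sub, adjoint_comp, one_def, adjoint_id, sub_apply, comp_apply, id_apply]
  have hR' : ‖adjoint R y‖ ≤ ‖y‖ := by
    simpa using le_of_opNorm_le _ ((LinearIsometryEquiv.norm_map adjoint R).trans_le hR) y
  have hC' : ∀ v, ‖adjoint C v‖ ≤ ‖v‖ := fun v => by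
    simpa using le_of_opNorm_le _ ((LinearIsometryEquiv.norm_map adjoint C).trans_le hC) v
  rw [hadj, hadj']
  refine (hC' _).trans (abs_le_of_sq_le_sq' ?_ (norm_nonneg _)).2
  rw [norm_sq_map_sub_smul_sub_smul hs (fun x v => (adjoint_inner_right A x v).symm) hA,
    sub_le_self_iff]
  have := pow_le_pow_left₀ (norm_nonneg _) hR' 2
  exact mul_nonneg (sq_nonneg s) (sub_nonneg.2 this)

end Adjoint

section RowColumn

open ContinuousLinearMap

variable {𝕜 ι E F : Type*} [RCLike 𝕜] [NormedAddCommGroup E] [NormedSpace 𝕜 E]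
  [NormedAddCommGroup F] [NormedSpace 𝕜 F]

/-- The row operator `(T₁, …, Tₙ) : v ↦ ∑ Tⱼ vⱼ` on the `ℓ²` sum of copies of `E`. -/
noncomputable def rowOperator [Fintype ι] (T : ι → E →L[𝕜] F) : PiLp 2 (fun _ : ι => E) →L[𝕜] F :=
  ∑ j, T j ∘L PiLp.proj 2 (fun _ : ι => E) j

/-- The column operator `y ↦ (conj a₁ y, …, conj aₙ y)` into the `ℓ²` sum of copies of `E`. The
conjugates make its composition with a row `(T₁, …, Tₙ)` the operator analogue of `⟪a, ·⟫`. -/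
noncomputable def scalarColumn (a : EuclideanSpace 𝕜 ι) : E →L[𝕜] PiLp 2 (fun _ : ι => E) :=
  (PiLp.continuousLinearEquiv 2 𝕜 fun _ : ι => E).symm.toContinuousLinearMap ∘L
    ContinuousLinearMap.pi fun j => star (a j) • ContinuousLinearMap.id 𝕜 E

theorem scalarColumn_apply (a : EuclideanSpace 𝕜 ι) (y : E) (j : ι) :
    scalarColumn a y j = star (a j) • y := rfl

variable [Fintype ι]

theorem rowOperator_apply (T : ι → E →L[𝕜] F) (v : PiLp 2 fun _ : ι => E) :
    rowOperator T v = ∑ j, T j (v j) := by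
  simp [rowOperator, sum_apply]

theorem rowOperator_comp_scalarColumn (T : ι → E →L[𝕜] F) (a : EuclideanSpace 𝕜 ι) :
    rowOperator T ∘L scalarColumn a = ∑ j, star (a j) • T j := by
  ext y
  simp [rowOperator_apply, scalarColumn_apply, sum_apply]

theorem norm_scalarColumn_apply (a : EuclideanSpace 𝕜 ι) (y : E) :
    ‖scalarColumn a y‖ = ‖a‖ * ‖y‖ := by
  rw [← sq_eq_sq₀ (norm_nonneg _) (by positivity), mul_pow, EuclideanSpace.norm_sq_eq,
    PiLp.norm_sq_eq_of_L2, Finset.sum_mul]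
  simp only [scalarColumn_apply, norm_smul, norm_star, mul_pow]

variable (E) in
theorem norm_scalarColumn_le (a : EuclideanSpace 𝕜 ι) :
    ‖(scalarColumn a : E →L[𝕜] PiLp 2 fun _ : ι => E)‖ ≤ ‖a‖ :=
  opNorm_le_bound _ (norm_nonneg a) fun y => (norm_scalarColumn_apply a y).le

theorem adjoint_scalarColumn_comp_scalarColumn {H : Type*} [NormedAddCommGroup H]
    [InnerProductSpace 𝕜 H] [CompleteSpace H] (a c : EuclideanSpace 𝕜 ι) :
    adjoint (scalarColumn a : H →L[𝕜] PiLp 2 fun _ : ι => H) ∘L scalarColumn c =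
      inner 𝕜 c a • 1 := by
  refine ContinuousLinearMap.ext fun y => ext_inner_left 𝕜 fun x => ?_
  rw [comp_apply, adjoint_inner_right, PiLp.inner_apply, smul_apply, inner_smul_right,
    one_apply_eq_self, PiLp.inner_apply, Finset.sum_mul]
  refine Finset.sum_congr rfl fun j _ => ?_
  simp only [scalarColumn_apply, inner_smul_left, inner_smul_right, RCLike.inner_apply,
    starRingEnd_apply, star_star]
  ring

end RowColumn

section BallInvolution

variable {𝕜 E : Type*} [RCLike 𝕜]

section Defect

variable [SeminormedAddCommGroup E]

/-- The number `√(1 - ‖a‖²)`, the defect of the contraction `c ↦ c • a`. -/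
noncomputable def defect (a : E) : ℝ := √(1 - ‖a‖ ^ 2)

theorem one_add_defect_pos (a : E) : 0 < 1 + defect a :=
  add_pos_of_pos_of_nonneg one_pos (Real.sqrt_nonneg _)

variable (𝕜) in
theorem one_add_defect_ne_zero (a : E) : (1 + defect a : 𝕜) ≠ 0 := by
  exact_mod_cast (one_add_defect_pos a).ne'

theorem one_sub_norm_sq_pos {a : E} (ha : ‖a‖ < 1) : 0 < 1 - ‖a‖ ^ 2 :=
  sub_pos.2 (pow_lt_one₀ (norm_nonneg a) ha two_ne_zero)

theorem defect_pos {a : E} (ha : ‖a‖ < 1) : 0 < defect a :=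
  Real.sqrt_pos.2 (one_sub_norm_sq_pos ha)

theorem norm_sq_eq_one_sub_defect_sq {a : E} (ha : ‖a‖ ≤ 1) : ‖a‖ ^ 2 = 1 - defect a ^ 2 := by
  rw [defect, Real.sq_sqrt (sub_nonneg.2 (pow_le_one₀ (norm_nonneg a) ha)), sub_sub_cancel]

end Defect

variable [NormedAddCommGroup E] [InnerProductSpace 𝕜 E] {a z : E}

variable (𝕜) in
/-- The involution of the unit ball which exchanges `0` and `a`. -/
noncomputable def ballInvolution (a z : E) : E :=
  (1 - inner 𝕜 a z)⁻¹ •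
    ((1 - (1 + defect a : 𝕜)⁻¹ * inner 𝕜 a z) • a - (defect a : 𝕜) • z)

theorem one_sub_inner_ne_zero (ha : ‖a‖ < 1) (hz : ‖z‖ < 1) : 1 - inner 𝕜 a z ≠ 0 := by
  refine sub_ne_zero.2 fun h => ?_
  have hlt : ‖inner 𝕜 a z‖ < 1 := (norm_inner_le_norm a z).trans_lt
    (mul_lt_one_of_nonneg_of_lt_one_left (norm_nonneg a) ha hz.le)
  rw [← h, norm_one] at hlt
  exact hlt.false

theorem inner_self_eq_one_sub_defect_sq (ha : ‖a‖ ≤ 1) :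
    inner 𝕜 a a = 1 - (defect a : 𝕜) ^ 2 := by
  rw [inner_self_eq_norm_sq_to_K, ← RCLike.ofReal_pow, norm_sq_eq_one_sub_defect_sq ha]
  push_cast
  rfl

theorem ballInvolution_self (ha : ‖a‖ ≤ 1) : ballInvolution 𝕜 a a = 0 := by
  have hs := one_add_defect_ne_zero 𝕜 a
  rw [ballInvolution, ← sub_smul, inner_self_eq_one_sub_defect_sq ha]
  have hcoeff : 1 - (1 + defect a : 𝕜)⁻¹ * (1 - (defect a : 𝕜) ^ 2) - defect a = 0 := by
    field_simp
    ring
  rw [hcoeff, zero_smul, smul_zero]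

theorem one_sub_inner_ballInvolution (ha : ‖a‖ < 1) (hz : ‖z‖ < 1) :
    1 - inner 𝕜 a (ballInvolution 𝕜 a z) = (defect a : 𝕜) ^ 2 / (1 - inner 𝕜 a z) := by
  have hz' : 1 - inner 𝕜 a z ≠ 0 := one_sub_inner_ne_zero ha hz
  have hs := one_add_defect_ne_zero 𝕜 a
  rw [ballInvolution, inner_smul_right, inner_sub_right, inner_smul_right, inner_smul_right,
    inner_self_eq_one_sub_defect_sq ha.le]
  field_simp
  ring

theorem ballInvolution_ballInvolution (ha : ‖a‖ < 1) (hz : ‖z‖ < 1) :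
    ballInvolution 𝕜 a (ballInvolution 𝕜 a z) = z := by
  have hz' : 1 - inner 𝕜 a z ≠ 0 := one_sub_inner_ne_zero ha hz
  have hs := one_add_defect_ne_zero 𝕜 a
  have hs0 : (defect a : 𝕜) ≠ 0 := by exact_mod_cast (defect_pos ha).ne'
  have hinner : inner 𝕜 a (ballInvolution 𝕜 a z) = 1 - (defect a : 𝕜) ^ 2 / (1 - inner 𝕜 a z) := by
    rw [← one_sub_inner_ballInvolution ha hz, sub_sub_cancel]
  rw [ballInvolution, hinner, ballInvolution]
  match_scalars <;> field_simp <;> ring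

theorem norm_sq_ballInvolution (ha : ‖a‖ < 1) (hz : ‖z‖ < 1) :
    ‖ballInvolution 𝕜 a z‖ ^ 2 =
      1 - (1 - ‖a‖ ^ 2) * (1 - ‖z‖ ^ 2) / ‖1 - inner 𝕜 a z‖ ^ 2 := by
  have hpos : ‖1 - inner 𝕜 a z‖ ≠ 0 := norm_ne_zero_iff.2 (one_sub_inner_ne_zero ha hz)
  have hnum := norm_sq_map_sub_smul_sub_smul (𝕜 := 𝕜) (A := fun c : 𝕜 => c • a) (B := inner 𝕜 a)
    (one_add_defect_pos a).ne' (fun c v => by simp [inner_smul_left, mul_comm])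
    (fun c => by rw [norm_smul, mul_pow, norm_sq_eq_one_sub_defect_sq ha.le, mul_comm]) 1 z
  rw [smul_eq_mul, norm_one, one_pow] at hnum
  rw [ballInvolution, norm_smul, mul_pow, hnum, norm_inv, norm_sq_eq_one_sub_defect_sq ha.le]
  field_simp
  ring

theorem norm_ballInvolution_lt_one (ha : ‖a‖ < 1) (hz : ‖z‖ < 1) : ‖ballInvolution 𝕜 a z‖ < 1 := by
  rw [← sq_lt_one_iff₀ (norm_nonneg _), norm_sq_ballInvolution ha hz, sub_lt_self_iff]
  have hpos : 0 < ‖1 - inner 𝕜 a z‖ := norm_pos_iff.2 (one_sub_inner_ne_zero ha hz)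
  have := one_sub_norm_sq_pos ha
  have := one_sub_norm_sq_pos hz
  positivity

theorem norm_ballInvolution_comm (ha : ‖a‖ < 1) (hz : ‖z‖ < 1) :
    ‖ballInvolution 𝕜 a z‖ = ‖ballInvolution 𝕜 z a‖ := by
  have h : ‖1 - inner 𝕜 a z‖ = ‖1 - inner 𝕜 z a‖ := by
    rw [← RCLike.norm_conj, map_sub, map_one, inner_conj_symm]
  rw [← sq_eq_sq₀ (norm_nonneg _) (norm_nonneg _), norm_sq_ballInvolution ha hz,
    norm_sq_ballInvolution hz ha, h, mul_comm (1 - ‖a‖ ^ 2)]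

theorem differentiableOn_ballInvolution (ha : ‖a‖ < 1) :
    DifferentiableOn 𝕜 (ballInvolution 𝕜 a) (Metric.ball 0 1) := by
  have hinner : Differentiable 𝕜 fun z : E => inner 𝕜 a z := (innerSL 𝕜 a).differentiable
  have hdenom : DifferentiableOn 𝕜 (fun z : E => (1 - inner 𝕜 a z)⁻¹) (Metric.ball 0 1) :=
    (hinner.const_sub 1).differentiableOn.inv fun z hz =>
      one_sub_inner_ne_zero ha (mem_ball_zero_iff.1 hz)
  refine hdenom.smul (Differentiable.differentiableOn ?_)
  exact (((hinner.const_mul _).const_sub 1).smul_const a).sub (differentiable_id.const_smul _)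

end BallInvolution

theorem isBallAutomorphism_ballInvolution {n : ℕ} (a : UnitBall n) :
    IsBallAutomorphism (ballInvolution ℂ a.1) := by
  have ha : ‖a.1‖ < 1 := mem_ball_zero_iff.1 a.2
  have hdiff := differentiableOn_ballInvolution (𝕜 := ℂ) ha
  have hmaps : Set.MapsTo (ballInvolution ℂ a.1) (UnitBall n) (UnitBall n) := fun z hz =>
    mem_ball_zero_iff.2 (norm_ballInvolution_lt_one ha (mem_ball_zero_iff.1 hz))
  have hinv : Set.LeftInvOn (ballInvolution ℂ a.1) (ballInvolution ℂ a.1) (UnitBall n) :=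
    fun z hz => ballInvolution_ballInvolution ha (mem_ball_zero_iff.1 hz)
  exact ⟨hdiff, hmaps, _, hdiff, hmaps, hinv, hinv⟩

theorem IsBallAutomorphism.norm_le_norm {n : ℕ} {F : Type*} [NormedAddCommGroup F]
    [NormedSpace ℂ F] {g : EuclideanSpace ℂ (Fin n) → EuclideanSpace ℂ (Fin n)}
    (hg : IsBallAutomorphism g) {f : EuclideanSpace ℂ (Fin n) → F}
    (hf : DifferentiableOn ℂ f (UnitBall n))
    (hfmaps : Set.MapsTo f (UnitBall n) (Metric.closedBall 0 1)) {z w : EuclideanSpace ℂ (Fin n)}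
    (hz : z ∈ UnitBall n) (hw : w ∈ UnitBall n) (hfz : f z = 0) (hgz : g z = 0) :
    ‖f w‖ ≤ ‖g w‖ := by
  obtain ⟨-, hgmaps, h, hh, hhmaps, hleft, -⟩ := hg
  have hzero : (f ∘ h) 0 = 0 := by rw [Function.comp_apply, ← hgz, hleft hz, hfz]
  have hschwarz := Complex.norm_le_norm_of_mapsTo_ball (hf.comp hh hhmaps) (hfmaps.comp hhmaps)
    hzero (mem_ball_zero_iff.1 (hgmaps hw))
  rwa [Function.comp_apply, hleft hw] at hschwarz

theorem pseudohyperbolicValues_eq {n : ℕ} (z w : UnitBall n) :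
    pseudohyperbolicValues z w = {‖ballInvolution ℂ z.1 w.1‖} := by
  have hinv := isBallAutomorphism_ballInvolution z
  have hzero : ballInvolution ℂ z.1 z.1 = 0 := ballInvolution_self (mem_ball_zero_iff.1 z.2).le
  ext r
  simp only [pseudohyperbolicValues, Set.mem_ofPred_eq, Set.mem_singleton_iff, dist_zero_left]
  constructor
  · rintro ⟨f, hf, hfz, rfl⟩
    have hball := Metric.ball_subset_closedBall (x := (0 : EuclideanSpace ℂ (Fin n))) (ε := 1)
    exact le_antisymm
      (hinv.norm_le_norm hf.1 (hf.2.1.mono_right hball) z.2 w.2 hfz hzero)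
      (hf.norm_le_norm hinv.1 (hinv.2.1.mono_right hball) z.2 w.2 hzero hfz)
  · rintro rfl
    exact ⟨_, hinv, hzero, rfl⟩

theorem pseudohyperbolicDist_eq {n : ℕ} (z w : UnitBall n) :
    pseudohyperbolicDist z w = ‖ballInvolution ℂ z.1 w.1‖ := by
  rw [pseudohyperbolicDist, pseudohyperbolicValues_eq, csInf_singleton]

namespace FockSpace

variable {n : ℕ}

theorem line_apply (α β : List (Fin n)) (c : ℂ) : line α c β = if β = α then c else 0 := by
  change lp.single (E := fun _ : List (Fin n) => ℂ) 2 α c β = _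
  rw [lp.single_apply, Pi.single_apply]

theorem inner_e_left (β : List (Fin n)) (x : FockSpace n) : inner ℂ (e β) x = x β := by
  simp [e, lp.inner_single_left]

theorem hasSum_creation_apply (j : Fin n) (x : FockSpace n) (β : List (Fin n)) :
    HasSum (fun α => if β = j :: α then x α else 0) (creation j x β) := by
  have hsum := (innerSL ℂ (e β)).hasSum ((orthogonalFamily_line_cons j).hasSum_linearIsometry x)
  simp only [innerSL_apply_apply, inner_e_left, line_apply] at hsum
  exact hsum

theorem creation_apply_nil (j : Fin n) (x : FockSpace n) : creation j x [] = 0 :=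
  (hasSum_creation_apply j x []).unique (by simp)

theorem creation_apply_cons (i j : Fin n) (x : FockSpace n) (α : List (Fin n)) :
    creation j x (i :: α) = if i = j then x α else 0 := by
  refine (hasSum_creation_apply j x (i :: α)).unique ?_
  split_ifs with h
  · simpa [h] using hasSum_single α fun β hβ => if_neg (Ne.symm hβ)
  · simp [h]

theorem orthogonalFamily_creation :
    OrthogonalFamily ℂ (fun _ : Fin n => FockSpace n)
      fun j => (orthogonalFamily_line_cons j).linearIsometry := by
  intro i j hij x y
  change inner ℂ (creation i x) (creation j y) = 0
  rw [lp.inner_eq_tsum]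
  refine (tsum_congr fun α => ?_).trans tsum_zero
  rcases α with _ | ⟨k, α⟩
  · rw [creation_apply_nil, inner_zero_left]
  · rw [creation_apply_cons, creation_apply_cons]
    split_ifs with hi hj
    · exact absurd (hi.symm.trans hj) hij
    all_goals simp

theorem norm_rowOperator_creation_apply (v : PiLp 2 fun _ : Fin n => FockSpace n) :
    ‖rowOperator creation v‖ = ‖v‖ := by
  rw [← sq_eq_sq₀ (norm_nonneg _) (norm_nonneg _), rowOperator_apply, PiLp.norm_sq_eq_of_L2]
  exact orthogonalFamily_creation.norm_sum v.ofLp Finset.univ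

theorem norm_rowOperator_creation_le : ‖rowOperator (creation (n := n))‖ ≤ 1 :=
  ContinuousLinearMap.opNorm_le_bound _ zero_le_one fun v => by
    rw [norm_rowOperator_creation_apply, one_mul]

end FockSpace

namespace hardyAlgebra

open FockSpace ContinuousLinearMap

variable {n : ℕ}

theorem sum_creation_kernelVector (w : UnitBall n) :
    ∑ j, star (w.1 j) • creation j (kernelVector w) = kernelVector w - e [] := by
  ext α
  simp only [lp.coeFn_sum, Finset.sum_apply, lp.coeFn_smul, Pi.smul_apply, lp.coeFn_sub,
    Pi.sub_apply]
  rcases α with _ | ⟨i, α⟩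
  · simp [creation_apply_nil, kernelVector, e]
  · simp [creation_apply_cons, kernelVector, e, mul_comm]

theorem inner_kernelVector_kernelVector (z w : UnitBall n) :
    inner ℂ (kernelVector z) (kernelVector w) = (1 - inner ℂ w.1 z.1)⁻¹ := by
  have hrec := congrArg (inner ℂ (kernelVector z)) (sum_creation_kernelVector w)
  simp only [inner_sum, inner_smul_right, inner_kernelVector_creation, inner_sub_right,
    inner_kernelVector_e, List.map_nil, List.prod_nil, ← mul_assoc, ← Finset.sum_mul] at hrec
  have hinner : ∑ j, star (w.1 j) * z.1 j = inner ℂ w.1 z.1 := by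
    simp [PiLp.inner_apply, mul_comm]
  rw [hinner] at hrec
  refine eq_inv_of_mul_eq_one_left ?_
  linear_combination -hrec

theorem norm_sq_kernelVector (z : UnitBall n) : ‖kernelVector z‖ ^ 2 = (1 - ‖z.1‖ ^ 2)⁻¹ := by
  have h := inner_kernelVector_kernelVector z z
  rw [inner_self_eq_norm_sq_to_K, inner_self_eq_norm_sq_to_K,
    RCLike.ofReal_eq_complex_ofReal] at h
  exact_mod_cast h

theorem norm_sq_ballInvolution_mul_norm_sq_kernelVector (z w : UnitBall n) :
    ‖ballInvolution ℂ z.1 w.1‖ ^ 2 * (‖kernelVector z‖ ^ 2 * ‖kernelVector w‖ ^ 2) =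
      ‖kernelVector z‖ ^ 2 * ‖kernelVector w‖ ^ 2 -
        ‖inner ℂ (kernelVector w) (kernelVector z)‖ ^ 2 := by
  have hz : ‖z.1‖ < 1 := mem_ball_zero_iff.1 z.2
  have hw : ‖w.1‖ < 1 := mem_ball_zero_iff.1 w.2
  have hz' := (one_sub_norm_sq_pos hz).ne'
  have hw' := (one_sub_norm_sq_pos hw).ne'
  rw [norm_sq_ballInvolution hz hw, norm_sq_kernelVector, norm_sq_kernelVector,
    inner_kernelVector_kernelVector, norm_inv]
  field_simp

/-- The character `φ ↦ ⟪k_l, φ(1)⟫` of `F_n^∞` given by the kernel vector at `l`: an explicit form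
of the evaluation at `l`. -/
noncomputable def kernelCharacter (l : UnitBall n) : hardyAlgebra n →ₐ[ℂ] ℂ :=
  AlgHom.ofLinearMap
    { toFun := fun φ => inner ℂ (kernelVector l) (φ.1 (e []))
      map_add' := fun _ _ => inner_add_right _ _ _
      map_smul' := fun _ _ => inner_smul_right _ _ _ }
    (by simpa using inner_kernelVector_e l [])
    fun φ ψ => inner_kernelVector_apply l φ (ψ.1 (e []))

theorem isRepresentationAt_kernelCharacter (l : UnitBall n) :
    IsRepresentationAt l.1 (kernelCharacter l) := by
  refine ⟨?_, fun j => ?_⟩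
  · let _ := weakStarTopology n
    have htoWOT : Continuous (toWOT (n := n)) := continuous_induced_dom
    exact (ContinuousLinearMapWOT.continuous_dual_apply (e [])
      (innerSL ℂ (kernelVector l))).comp htoWOT
  · change inner ℂ (kernelVector l) (creation j (e [])) = l.1 j
    simp [inner_kernelVector_creation, inner_kernelVector_e]

theorem isRepresentationAt_representationAt (l : UnitBall n) :
    IsRepresentationAt l.1 (representationAt l) :=
  (existsUnique_representation l).choose_spec.1

theorem eval_eq_inner (φ : hardyAlgebra n) (l : UnitBall n) :
    eval φ l = inner ℂ (kernelVector l) (φ.1 (e [])) :=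
  DFunLike.congr_fun (representation_unique (isRepresentationAt_representationAt l)
    (isRepresentationAt_kernelCharacter l)) φ

theorem adjoint_apply_kernelVector (φ : hardyAlgebra n) (l : UnitBall n) :
    adjoint φ.1 (kernelVector l) = star (eval φ l) • kernelVector l := by
  refine ext_inner_right ℂ fun x => ?_
  rw [adjoint_inner_left, inner_kernelVector_apply, ← eval_eq_inner, inner_smul_left,
    starRingEnd_apply, star_star]

theorem norm_eval_le {φ : hardyAlgebra n} (hφ : ‖φ‖ ≤ 1) {z w : UnitBall n}
    (hw : eval φ w = 0) : ‖eval φ z‖ ≤ ‖ballInvolution ℂ z.1 w.1‖ := by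
  have hcontr : ∀ x, ‖(adjoint φ.1 : FockSpace n →ₗ[ℂ] FockSpace n) x‖ ≤ ‖x‖ := fun x => by
    simpa using le_of_opNorm_le _ ((LinearIsometryEquiv.norm_map adjoint φ.1).trans_le hφ) x
  have hkill : (adjoint φ.1 : FockSpace n →ₗ[ℂ] FockSpace n) (kernelVector w) = 0 := by
    rw [coe_coe, adjoint_apply_kernelVector, hw, star_zero, zero_smul]
  have hle := norm_sq_map_mul_norm_sq_le_of_map_eq_zero hcontr hkill (kernelVector z)
  rw [coe_coe, adjoint_apply_kernelVector, norm_smul, norm_star, mul_pow, mul_assoc,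
    ← norm_sq_ballInvolution_mul_norm_sq_kernelVector] at hle
  have hpos : ∀ l : UnitBall n, 0 < ‖kernelVector l‖ ^ 2 := fun l => by
    rw [norm_sq_kernelVector]
    exact inv_pos.2 (one_sub_norm_sq_pos (mem_ball_zero_iff.1 l.2))
  exact (sq_le_sq₀ (norm_nonneg _) (norm_nonneg _)).1
    (le_of_mul_le_mul_right hle (mul_pos (hpos z) (hpos w)))

theorem isClosed (n : ℕ) : IsClosed (hardyAlgebra n : Set (FockSpace n →L[ℂ] FockSpace n)) := by
  have h : (hardyAlgebra n : Set (FockSpace n →L[ℂ] FockSpace n)) =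
      ContinuousLinearMapWOT.ofCLM ⁻¹' closure (Algebra.adjoin ℂ (Set.range fun j : Fin n =>
        ContinuousLinearMapWOT.ofCLM (creation j)) : Set (FockSpace n →WOT[ℂ] FockSpace n)) :=
    Set.ext fun _ => mem_iff
  rw [h]
  exact isClosed_closure.preimage ContinuousLinearMapWOT.continuous_ofCLM

instance : CompleteSpace (hardyAlgebra n) := (isClosed n).completeSpace_coe

/-- The element `∑ conj (a_j) S_j` of `F_n^∞`, whose value at `l` is `⟪a, l⟫`. -/
noncomputable def linearForm (a : EuclideanSpace ℂ (Fin n)) : hardyAlgebra n :=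
  ∑ j, star (a j) • S j

theorem coe_linearForm (a : EuclideanSpace ℂ (Fin n)) :
    (linearForm a : FockSpace n →L[ℂ] FockSpace n) = rowOperator creation ∘L scalarColumn a := by
  rw [rowOperator_comp_scalarColumn]
  simp [linearForm, S]

theorem coe_one_sub_linearForm (a : EuclideanSpace ℂ (Fin n)) :
    (1 - linearForm a : hardyAlgebra n).1 = 1 - rowOperator creation ∘L scalarColumn a :=
  congrArg (1 - ·) (coe_linearForm a)

theorem eval_linearForm (a : EuclideanSpace ℂ (Fin n)) (l : UnitBall n) :
    eval (linearForm a) l = inner ℂ a l.1 := by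
  simp [eval, linearForm, (isRepresentationAt_representationAt l).2, PiLp.inner_apply, mul_comm]

theorem norm_linearForm_le (a : EuclideanSpace ℂ (Fin n)) : ‖linearForm a‖ ≤ ‖a‖ := by
  change ‖(linearForm a).1‖ ≤ ‖a‖
  rw [coe_linearForm]
  calc ‖rowOperator creation ∘L scalarColumn a‖ ≤
      ‖rowOperator (creation (n := n))‖ *
        ‖(scalarColumn a : FockSpace n →L[ℂ] PiLp 2 fun _ : Fin n => FockSpace n)‖ :=
        opNorm_comp_le _ _
    _ ≤ 1 * ‖a‖ := by
      gcongr
      exacts [norm_rowOperator_creation_le, norm_scalarColumn_le _ a]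
    _ = ‖a‖ := one_mul _

/-- The numerator of `⟪c, f_a⟫` with its variable replaced by `(S_1, …, S_n)`, where
`f_a = ballInvolution ℂ a`. -/
noncomputable def involutionNumerator (a c : EuclideanSpace ℂ (Fin n)) : hardyAlgebra n :=
  inner ℂ c a • (1 - (1 + defect a : ℂ)⁻¹ • linearForm a) - (defect a : ℂ) • linearForm c

theorem coe_involutionNumerator (a c : EuclideanSpace ℂ (Fin n)) :
    (involutionNumerator a c : FockSpace n →L[ℂ] FockSpace n) =
      (1 - (1 + defect a : ℂ)⁻¹ • rowOperator creation ∘L scalarColumn a) ∘L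
        adjoint (scalarColumn a) ∘L scalarColumn c -
          (defect a : ℂ) • rowOperator creation ∘L scalarColumn c := by
  rw [adjoint_scalarColumn_comp_scalarColumn, ← coe_linearForm, ← coe_linearForm, comp_smul]
  rfl

theorem eval_involutionNumerator (a c : EuclideanSpace ℂ (Fin n)) (l : UnitBall n) :
    eval (involutionNumerator a c) l = inner ℂ c
      ((1 - (1 + defect a : ℂ)⁻¹ * inner ℂ a l.1) • a - (defect a : ℂ) • l.1) := by
  have ha := eval_linearForm a l
  have hc := eval_linearForm c l
  simp only [eval] at ha hc
  simp only [eval, involutionNumerator, map_sub, map_smul, map_one, ha, hc, inner_sub_right,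
    inner_smul_right, smul_eq_mul, mul_comm]

theorem norm_adjoint_involutionNumerator_apply_le {a c : EuclideanSpace ℂ (Fin n)} (ha : ‖a‖ ≤ 1)
    (hc : ‖c‖ ≤ 1) (y : FockSpace n) :
    ‖adjoint (involutionNumerator a c).1 y‖ ≤ ‖adjoint (1 - linearForm a).1 y‖ := by
  have hA : ∀ x : FockSpace n, ‖scalarColumn a x‖ ^ 2 = (1 - defect a ^ 2) * ‖x‖ ^ 2 := fun x => by
    rw [norm_scalarColumn_apply, mul_pow, norm_sq_eq_one_sub_defect_sq ha]
  rw [coe_involutionNumerator, coe_one_sub_linearForm]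
  exact norm_adjoint_mobius_apply_le (𝕜 := ℂ) (one_add_defect_pos a).ne' hA
    ((norm_scalarColumn_le _ c).trans hc) norm_rowOperator_creation_le y

theorem exists_eval_eq_inner_ballInvolution {a c : EuclideanSpace ℂ (Fin n)} (ha : ‖a‖ < 1)
    (hc : ‖c‖ ≤ 1) :
    ∃ φ : hardyAlgebra n, ‖φ‖ ≤ 1 ∧
      ∀ l : UnitBall n, eval φ l = inner ℂ c (ballInvolution ℂ a l.1) := by
  let u := Units.oneSub (linearForm a) ((norm_linearForm_le a).trans_lt ha)
  have hu : (↑u⁻¹ : hardyAlgebra n) * (1 - linearForm a) = 1 := u.inv_mul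
  refine ⟨(↑u⁻¹ : hardyAlgebra n) * involutionNumerator a c, ?_, fun l => ?_⟩
  · calc ‖(↑u⁻¹ : hardyAlgebra n) * involutionNumerator a c‖
        ≤ ‖(↑u⁻¹ : hardyAlgebra n) * (1 - linearForm a)‖ :=
          norm_comp_le_norm_comp_of_norm_adjoint_apply_le
            (norm_adjoint_involutionNumerator_apply_le ha.le hc) (↑u⁻¹ : hardyAlgebra n).1
      _ = ‖(1 : hardyAlgebra n)‖ := by rw [hu]
      _ ≤ 1 := norm_id_le
  · have hinv : eval ↑u⁻¹ l = (1 - inner ℂ a l.1)⁻¹ := by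
      refine eq_inv_of_mul_eq_one_left ?_
      have h := congrArg (representationAt l) hu
      rw [map_mul, map_sub, map_one] at h
      rwa [← eval_linearForm]
    have hmul : eval ((↑u⁻¹ : hardyAlgebra n) * involutionNumerator a c) l =
        eval ↑u⁻¹ l * eval (involutionNumerator a c) l := map_mul (representationAt l) _ _
    rw [hmul, hinv, eval_involutionNumerator, ballInvolution, inner_smul_right]
    rfl

end hardyAlgebra

theorem mainTheorem4 (n : ℕ) (hn : 0 < n) (z w : UnitBall n) :
    pseudohyperbolicValues z w = {pseudohyperbolicDist z w} ∧
      IsGreatest {r : ℝ | ∃ φ : hardyAlgebra n, ‖φ‖ ≤ 1 ∧ hardyAlgebra.eval φ w = 0 ∧ r = ‖hardyAlgebra.eval φ z‖}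
        (pseudohyperbolicDist z w) := by
  have hz : ‖z.1‖ < 1 := mem_ball_zero_iff.1 z.2
  have hw : ‖w.1‖ < 1 := mem_ball_zero_iff.1 w.2
  rw [pseudohyperbolicDist_eq]
  refine ⟨pseudohyperbolicValues_eq z w, ?_, ?_⟩
  · obtain ⟨g, hg, hgv⟩ := exists_dual_vector'' ℂ (ballInvolution ℂ w.1 z.1)
    obtain ⟨c, rfl⟩ := (InnerProductSpace.toDual ℂ (EuclideanSpace ℂ (Fin n))).surjective g
    rw [LinearIsometryEquiv.norm_map] at hg
    obtain ⟨φ, hφ, heval⟩ := hardyAlgebra.exists_eval_eq_inner_ballInvolution hw hg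
    refine ⟨φ, hφ, ?_, ?_⟩
    · rw [heval, ballInvolution_self hw.le, inner_zero_right]
    · rw [heval, ← InnerProductSpace.toDual_apply_apply, hgv, RCLike.norm_ofReal, abs_norm,
        norm_ballInvolution_comm hz hw]
  · rintro r ⟨φ, hφ, hφw, rfl⟩
    exact hardyAlgebra.norm_eval_le hφ hφw
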